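/- Let $X$ be a non-empty finite set of items. A valuation on $X$ is a function $v:2^X\to\mathbb R_{\ge 0}$ with $v(\emptyset)=0$ and $v(A)\le v(B)$ whenever $A\subseteq B$. Define the following classes of valuations on $X$. - $CF$ (complement-free): $v(A\cup B)\le v(A)+v(B)$ for all $A,B\subseteq X$. - $SM$ (submodular): $v(T\cup\{x\})-v(T)\le v(S\cup\{x\})-v(S)$ for all $S\subseteq T\subseteq X$ and $x\in X$. - $GS$ (gross substitutes): for $p\in\mathbb R^X$ let $D(v\mid p)$ be the set of all $S\subseteq X$ that maximize $v(S)-\sum_{i\in S}p_i$. Then $v\in GS$ if for every item $i$ and all $p,q\in\mathbb R^X$ with $q\ge p$ coordinatewise and $q_i=p_i$: if $i\in A$ for some $A\in D(v\mid p)$, then $i\in A'$ for some $A'\in D(v\mid q)$. - For $x\in X$ and $p\ge 0$ the singleton valuation $e_x^p$ has $e_x^p(S)=p$ if $x\in S$ and $e_x^p(S)=0$ otherwise. Put $(v_1\oplus v_2)(S)=\max(v_1(S),v_2(S))$ (XOR) and $(v_1\vee v_2)(S)=\max_{T\subseteq S}\bigl(v_1(T)+v_2(S\setminus T)\bigr)$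 (OR). $OXS$ is the class of ORs of one or more valuations, each of which is an XOR of one or more singleton valuations; $XOS$ is the class of XORs of one or more valuations, each of which is an OR of one or more singleton valuations. Theorem. For every non-empty finite $X$, $$OXS\subseteq GS\subseteq SM\subseteq XOS\subseteq CF .$$ The containments are strict: $OXS\ne GS$ whenever $|X|\ge 4$, and $GS\ne SM$, $SM\ne XOS$, $XOS\ne CF$ whenever $|X|\ge 3$. Explicit separating examples are the following. 1. $X=\{a,b,c,d\}$, $v(S)=10$ if $|S|=1$, $v(\{a,c\})=v(\{b,d\})=15$, and $v(S)=19$ for all other non-empty $S$: $v\in GS$ and $v\notin OXS$. 2. $X=\{1,2,3\}$, $v(S)=\min\bigl(4,\sum_{i\in S}w_i\bigr)$ with $w=(2,2,4)$: $v\in SM$ and $v\notin GS$. 3. $|X|=3$, $v(S)=2$ if $|S|\in\{1,2\}$ and $v(X)=3$ (and $v(\emptyset)=0$): $v\in XOS$ and $v\notin SM$. 4. $|X|=3$, $v(S)=2,3,5$ if $|S|=1,2,3$ respectively (and $v(\emptyset)=0$): $v\in CF$ and $v\notin XOS$. -/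

import Mathlib

namespace CombinatorialAuction

/-- A valuation on the subsets of a set `X` of items: normalized and monotone (free disposal).
Values are non-negative, see `ItemValuation.nonneg`. -/
@[ext]
structure ItemValuation (X : Type*) where
  toFun : Finset X → ℝ
  map_empty' : toFun ∅ = 0
  mono' : ∀ A B : Finset X, A ⊆ B → toFun A ≤ toFun B

instance {X : Type*} : CoeFun (ItemValuation X) (fun _ => Finset X → ℝ) := ⟨ItemValuation.toFun⟩

theorem ItemValuation.nonneg {X : Type*} (v : ItemValuation X) (S : Finset X) : 0 ≤ v S := by
  have h := v.mono' ∅ S (Finset.empty_subset S)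
  rwa [v.map_empty'] at h

/-- The marginal valuation `v(A ∣ W)`. -/
def marginal {X : Type*} [DecidableEq X] (v : ItemValuation X) (A W : Finset X) : ℝ :=
  v (A ∪ W) - v W

/-- Complement-free valuations. -/
def CF (X : Type*) [DecidableEq X] : Set (ItemValuation X) :=
  {v | ∀ A B : Finset X, v (A ∪ B) ≤ v A + v B}

/-- Submodular valuations (decreasing marginal utilities). -/
def SM (X : Type*) [DecidableEq X] : Set (ItemValuation X) :=
  {v | ∀ S T : Finset X, S ⊆ T → ∀ x : X, marginal v {x} T ≤ marginal v {x} S}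

/-- The surplus of `S` at the (real) item prices `p`. -/
def surplus {X : Type*} (v : ItemValuation X) (p : X → ℝ) (S : Finset X) : ℝ :=
  v S - ∑ i ∈ S, p i

/-- The demand set: all the sets that maximize the surplus at prices `p`. -/
def demand {X : Type*} (v : ItemValuation X) (p : X → ℝ) : Set (Finset X) :=
  {S | ∀ T : Finset X, surplus v p T ≤ surplus v p S}

/-- Valuations with the gross substitutes property. -/
def GS (X : Type*) : Set (ItemValuation X) :=
  {v | ∀ (i : X) (p q : X → ℝ), p ≤ q → p i = q i →
    ∀ A ∈ demand v p, i ∈ A → ∃ A' ∈ demand v q, i ∈ A'}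

/-- The singleton valuation: value `p` for the sets that contain `x`, and `0` for the others. -/
def single {X : Type*} [DecidableEq X] (x : X) (p : ℝ) (hp : 0 ≤ p) : ItemValuation X where
  toFun S := if x ∈ S then p else 0
  map_empty' := by simp
  mono' A B h := by
    by_cases hA : x ∈ A
    · simp [hA, h hA]
    · by_cases hB : x ∈ B <;> simp [hA, hB, hp]

/-- The exclusive combination `v₁ ⊕ v₂`. -/
def xorVal {X : Type*} (v₁ v₂ : ItemValuation X) : ItemValuation X where
  toFun S := max (v₁ S) (v₂ S)
  map_empty' := by simp [v₁.map_empty', v₂.map_empty']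
  mono' A B h := max_le_max (v₁.mono' A B h) (v₂.mono' A B h)

/-- The non-exclusive combination `v₁ ∨ v₂`: a bundle is split optimally between `v₁`, `v₂`. -/
def orVal {X : Type*} [DecidableEq X] (v₁ v₂ : ItemValuation X) : ItemValuation X where
  toFun S := S.powerset.sup' ⟨∅, Finset.empty_mem_powerset S⟩ (fun T => v₁ T + v₂ (S \ T))
  map_empty' := by simp [v₁.map_empty', v₂.map_empty']
  mono' A B h := by
    refine Finset.sup'_le _ _ fun T hT => ?_
    have hTA : T ⊆ A := Finset.mem_powerset.1 hT
    refine le_trans (add_le_add le_rfl (v₂.mono' (A \ T) (B \ T) (Finset.sdiff_subset_sdiff h le_rfl))) ?_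
    exact Finset.le_sup' (fun T => v₁ T + v₂ (B \ T)) (Finset.mem_powerset.2 (hTA.trans h))

/-- The valuations `v₁ ∨ ⋯ ∨ vₖ` with `k ≥ 1` and all `vᵢ` in `C`. -/
inductive OrsOf {X : Type*} [DecidableEq X] (C : Set (ItemValuation X)) : ItemValuation X → Prop
  | base (v : ItemValuation X) : v ∈ C → OrsOf C v
  | or (v w : ItemValuation X) : OrsOf C v → OrsOf C w → OrsOf C (orVal v w)

/-- The valuations `v₁ ⊕ ⋯ ⊕ vₖ` with `k ≥ 1` and all `vᵢ` in `C`. -/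
inductive XorsOf {X : Type*} (C : Set (ItemValuation X)) : ItemValuation X → Prop
  | base (v : ItemValuation X) : v ∈ C → XorsOf C v
  | xor (v w : ItemValuation X) : XorsOf C v → XorsOf C w → XorsOf C (xorVal v w)

/-- Singleton valuations. -/
def Singles (X : Type*) [DecidableEq X] : Set (ItemValuation X) :=
  {v | ∃ (x : X) (p : ℝ) (hp : 0 ≤ p), v = single x p hp}

/-- ORs of singleton valuations. -/
def OS (X : Type*) [DecidableEq X] : Set (ItemValuation X) := {v | OrsOf (Singles X) v}

/-- XORs of singleton valuations. -/
def XS (X : Type*) [DecidableEq X] : Set (ItemValuation X) := {v | XorsOf (Singles X) v}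

/-- ORs of XORs of singleton valuations. -/
def OXS (X : Type*) [DecidableEq X] : Set (ItemValuation X) := {v | OrsOf (XS X) v}

/-- XORs of ORs of singleton valuations. -/
def XOS (X : Type*) [DecidableEq X] : Set (ItemValuation X) := {v | XorsOf (OS X) v}

/-- Four items `0, 1, 2, 3`: singletons have value 10, `{0, 2}` and `{1, 3}` have value 15, and all
the other non-empty sets have value 19. -/
def fourItemExample : ItemValuation (Fin 4) where
  toFun S := ((if S = ∅ then 0 else if S.card = 1 then 10
    else if S = {0, 2} ∨ S = {1, 3} then 15 else 19 : ℕ) : ℝ)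
  map_empty' := by simp
  mono' A B h := by
    refine Nat.cast_le.2 ?_
    revert A B
    decide

/-- Three items with values 2, 2, 4, additive up to the budget limit 4. -/
def budgetExample : ItemValuation (Fin 3) where
  toFun S := min 4 (∑ i ∈ S, (![2, 2, 4] : Fin 3 → ℝ) i)
  map_empty' := by simp
  mono' A B h := by
    refine min_le_min le_rfl (Finset.sum_le_sum_of_subset_of_nonneg h fun i _ _ => ?_)
    fin_cases i <;> simp

/-- Three items: sets of one or two items have value 2, the set of all three has value 3. -/
def xosExample : ItemValuation (Fin 3) where
  toFun S := ((if S.card = 0 then 0 else if S.card ≤ 2 then 2 else 3 : ℕ) : ℝ)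
  map_empty' := by simp
  mono' A B h := by
    refine Nat.cast_le.2 ?_
    revert A B
    decide

/-- Three items: sets of one, two, three items have value 2, 3, 5 respectively. -/
def cfExample : ItemValuation (Fin 3) where
  toFun S := ((if S.card = 0 then 0 else if S.card = 1 then 2
    else if S.card = 2 then 3 else 5 : ℕ) : ℝ)
  map_empty' := by simp
  mono' A B h := by
    refine Nat.cast_le.2 ?_
    revert A B
    decide

end CombinatorialAuction

/-! Two characterizations carry the chain. A valuation in `OXS` is an assignment valuation
(`IsAssignment`): each XOR clause is a bidder who takes at most one item, and a bundle is worth its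
maximum weight matching. Swapping two matchings along an alternating path (`IsMatching.exchange`)
gives the exchange property `HasExchange`, and exchanging a demanded set at the old prices against
one at the new prices gives `GS`.

A valuation is in `XOS` exactly when every set has a supporting additive valuation (`HasSupports`).
For `SM` the greedy marginals are such a support (`hasSupports_of_mem_SM`); for `XOS ⊆ CF` one
support of `A ∪ B` bounds both parts. For `GS ⊆ SM`, extreme prices reduce the demand to a decision
about a single item, taken by comparing its price with its marginal value.

Strictness on a larger `X` comes from embedding the items of an example into `X` and making all
other items worthless (`extend`). Each separation survives because the positive property passes to
the extension, and either the negative one is proved there directly or its negation passes back. -/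

namespace CombinatorialAuction

set_option linter.unusedSectionVars false

/-! ### Exchange implies gross substitutes -/

section Exchange

variable {X : Type*} [DecidableEq X]

/-- The `M♮`-concave exchange property. -/
def HasExchange (v : ItemValuation X) : Prop :=
  ∀ (A B : Finset X) (i : X), i ∈ A → i ∉ B →
    v A + v B ≤ v (A.erase i) + v (insert i B) ∨
    ∃ j ∈ B, j ∉ A ∧ v A + v B ≤ v (insert j (A.erase i)) + v (insert i (B.erase j))

theorem demand_nonempty [Fintype X] (v : ItemValuation X) (p : X → ℝ) : (demand v p).Nonempty := by
  obtain ⟨S, -, hS⟩ := Finset.exists_max_image (Finset.univ : Finset (Finset X)) (surplus v p)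
    Finset.univ_nonempty
  exact ⟨S, fun T => hS T (Finset.mem_univ T)⟩

/-- The exchange cannot raise the surplus of `A` at `p`, so `B` gains at least `p i - p j` in value
(`p i` if no `j` leaves). As `q i = p i` and `q j ≥ p j`, this covers the change of its cost at `q`,
so the new set is still optimal. -/
theorem HasExchange.mem_GS [Fintype X] {v : ItemValuation X} (hv : HasExchange v) : v ∈ GS X := by
  intro i p q hpq hi A hA hiA
  obtain ⟨B, hB⟩ := demand_nonempty v q
  by_cases hiB : i ∈ B
  · exact ⟨B, hB, hiB⟩
  have hpA := Finset.add_sum_erase A p hiA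
  rcases hv A B i hiA hiB with h | ⟨j, hjB, hjA, h⟩
  · refine ⟨insert i B, fun T => (hB T).trans ?_, Finset.mem_insert_self _ _⟩
    have h1 := hA (A.erase i)
    simp only [surplus, Finset.sum_insert hiB] at h1 ⊢
    linarith
  · refine ⟨insert i (B.erase j), fun T => (hB T).trans ?_, Finset.mem_insert_self _ _⟩
    have h1 := hA (insert j (A.erase i))
    have h2 : i ∉ B.erase j := fun h => hiB (Finset.mem_of_mem_erase h)
    have h3 : j ∉ A.erase i := fun h => hjA (Finset.mem_of_mem_erase h)
    have hqB := Finset.add_sum_erase B q hjB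
    have := hpq j
    simp only [surplus, Finset.sum_insert h2, Finset.sum_insert h3] at h1 ⊢
    linarith

end Exchange

/-! ### Assignment valuations, `OXS ⊆ GS`, and an obstruction to `OXS` -/

section Matching

variable {ι X : Type*} [DecidableEq ι] [DecidableEq X]

/-- `f` is a partial matching of the bidders in `U` to distinct items of `S`. -/
structure IsMatching (U : Finset ι) (f : ι → Option X) (S : Finset X) : Prop where
  mem : ∀ b ∈ U, ∀ x, f b = some x → x ∈ S
  inj : ∀ b ∈ U, ∀ c ∈ U, ∀ x, f b = some x → f c = some x → b = c

/-- The total weight of a partial matching. -/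
def matchValue (w : ι → X → ℝ) (U : Finset ι) (f : ι → Option X) : ℝ :=
  ∑ b ∈ U, (f b).elim 0 (w b)

theorem IsMatching.mono {U : Finset ι} {f : ι → Option X} {S T : Finset X}
    (h : IsMatching U f S) (hST : S ⊆ T) : IsMatching U f T :=
  ⟨fun b hb x hx => hST (h.mem b hb x hx), h.inj⟩

theorem IsMatching.erase_of_eq_some {U : Finset ι} {f : ι → Option X} {S : Finset X}
    (h : IsMatching U f S) {b : ι} (hb : b ∈ U) {x : X} (hx : f b = some x) :
    IsMatching (U.erase b) f (S.erase x) := by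
  refine ⟨fun c hc y hy => Finset.mem_erase.2 ⟨?_, h.mem c (Finset.mem_of_mem_erase hc) y hy⟩,
    fun c hc d hd => h.inj c (Finset.mem_of_mem_erase hc) d (Finset.mem_of_mem_erase hd)⟩
  rintro rfl
  exact (Finset.mem_erase.1 hc).1 (h.inj c (Finset.mem_of_mem_erase hc) b hb y hy hx)

theorem IsMatching.erase {U : Finset ι} {f : ι → Option X} {S : Finset X}
    (h : IsMatching U f S) (b : ι) : IsMatching (U.erase b) f S :=
  ⟨fun c hc => h.mem c (Finset.mem_of_mem_erase hc),
    fun c hc d hd => h.inj c (Finset.mem_of_mem_erase hc) d (Finset.mem_of_mem_erase hd)⟩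

theorem IsMatching.update_some {U : Finset ι} {f : ι → Option X} {S : Finset X} {b : ι}
    (h : IsMatching (U.erase b) f S) {x : X} (hx : x ∉ S) :
    IsMatching U (Function.update f b (some x)) (insert x S) := by
  have hm : ∀ c ∈ U, c ≠ b → ∀ y, f c = some y → y ∈ S :=
    fun c hc hcb => h.mem c (Finset.mem_erase.2 ⟨hcb, hc⟩)
  constructor
  · intro c hc y hy
    by_cases hcb : c = b
    · subst hcb
      simp only [Function.update_self, Option.some.injEq] at hy
      simp [hy]
    · rw [Function.update_of_ne hcb] at hy
      exact Finset.mem_insert_of_mem (hm c hc hcb y hy)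
  · intro c hc d hd y hcy hdy
    by_cases hcb : c = b <;> by_cases hdb : d = b
    · rw [hcb, hdb]
    · subst hcb
      rw [Function.update_of_ne hdb] at hdy
      simp only [Function.update_self, Option.some.injEq] at hcy
      exact absurd (hcy ▸ hm d hd hdb y hdy) hx
    · subst hdb
      rw [Function.update_of_ne hcb] at hcy
      simp only [Function.update_self, Option.some.injEq] at hdy
      exact absurd (hdy ▸ hm c hc hcb y hcy) hx
    · rw [Function.update_of_ne hcb] at hcy
      rw [Function.update_of_ne hdb] at hdy
      exact h.inj c (Finset.mem_erase.2 ⟨hcb, hc⟩) d (Finset.mem_erase.2 ⟨hdb, hd⟩) y hcy hdy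

theorem IsMatching.update_none {U : Finset ι} {f : ι → Option X} {S : Finset X} {b : ι}
    (h : IsMatching (U.erase b) f S) : IsMatching U (Function.update f b none) S := by
  have hne : ∀ c y, Function.update f b none c = some y → c ≠ b ∧ f c = some y := by
    intro c y hy
    by_cases hcb : c = b
    · subst hcb
      simp at hy
    · rw [Function.update_of_ne hcb] at hy
      exact ⟨hcb, hy⟩
  constructor
  · intro c hc y hy
    obtain ⟨h1, h2⟩ := hne c y hy
    exact h.mem c (Finset.mem_erase.2 ⟨h1, hc⟩) y h2
  · intro c hc d hd y hcy hdy
    obtain ⟨h1, h2⟩ := hne c y hcy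
    obtain ⟨h3, h4⟩ := hne d y hdy
    exact h.inj c (Finset.mem_erase.2 ⟨h1, hc⟩) d (Finset.mem_erase.2 ⟨h3, hd⟩) y h2 h4

theorem matchValue_update (w : ι → X → ℝ) {U : Finset ι} {b : ι} (hb : b ∈ U)
    (f : ι → Option X) (o : Option X) :
    matchValue w U (Function.update f b o) = o.elim 0 (w b) + matchValue w (U.erase b) f := by
  unfold matchValue
  rw [← Finset.add_sum_erase U _ hb, Function.update_self]
  congr 1
  refine Finset.sum_congr rfl fun c hc => ?_
  rw [Function.update_of_ne (Finset.ne_of_mem_erase hc)]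

theorem matchValue_erase (w : ι → X → ℝ) {U : Finset ι} {b : ι} (hb : b ∈ U) (f : ι → Option X) :
    matchValue w U f = (f b).elim 0 (w b) + matchValue w (U.erase b) f :=
  (Finset.add_sum_erase U _ hb).symm

/-- Exchange for matchings, by swapping along the alternating path that starts at `i`. -/
theorem IsMatching.exchange (w : ι → X → ℝ) (U : Finset ι) :
    ∀ (f g : ι → Option X) (A B : Finset X) (i : X), IsMatching U f A → IsMatching U g B →
      i ∈ A → i ∉ B → ∃ f' g' : ι → Option X,
        matchValue w U f + matchValue w U g = matchValue w U f' + matchValue w U g' ∧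
        ((IsMatching U f' (A.erase i) ∧ IsMatching U g' (insert i B)) ∨
          ∃ j ∈ B, j ∉ A ∧ IsMatching U f' (insert j (A.erase i)) ∧
            IsMatching U g' (insert i (B.erase j))) := by
  induction U using Finset.strongInduction with
  | H U ih =>
  intro f g A B i hf hg hiA hiB
  by_cases h : ∃ b ∈ U, f b = some i
  · obtain ⟨b, hb, hfb⟩ := h
    have hf1 := hf.erase_of_eq_some hb hfb
    -- The bidder `b` who holds `i` under `f` hands it to its copy under `g`, and the item `x` held
    -- there, if any, moves the other way.
    cases hgb : g b with
    | none =>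
      refine ⟨Function.update f b none, Function.update g b (some i), ?_,
        Or.inl ⟨hf1.update_none, (hg.erase b).update_some hiB⟩⟩
      rw [matchValue_update w hb, matchValue_update w hb, matchValue_erase w hb f,
        matchValue_erase w hb g, hfb, hgb]
      ring
    | some x =>
      have hg1 := hg.erase_of_eq_some hb hgb
      have hxB := hg.mem b hb x hgb
      have hiB' : i ∉ B.erase x := fun h => hiB (Finset.mem_of_mem_erase h)
      have hxi : x ≠ i := fun h => hiB (h ▸ hxB)
      -- If `x ∈ A`, another bidder may hold `x` under `f`; the path continues from `x` with `b`
      -- removed. Otherwise it ends with `j = x`.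
      by_cases hxA : x ∈ A
      · obtain ⟨f', g', hval, hm⟩ := ih (U.erase b) (Finset.erase_ssubset hb) f g (A.erase i)
          (B.erase x) x hf1 hg1 (Finset.mem_erase.2 ⟨hxi, hxA⟩) (Finset.notMem_erase x B)
        refine ⟨Function.update f' b (some x), Function.update g' b (some i), ?_, ?_⟩
        · rw [matchValue_update w hb, matchValue_update w hb, matchValue_erase w hb f,
            matchValue_erase w hb g, hfb, hgb]
          simp only [Option.elim_some]
          linarith
        · rcases hm with ⟨h1, h2⟩ | ⟨j, hjB, hjA, h1, h2⟩
          · left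
            refine ⟨(h1.update_some (Finset.notMem_erase _ _)).mono (by grind),
              (h2.update_some (by grind)).mono (by grind)⟩
          · right
            refine ⟨j, by grind, by grind, (h1.update_some (by grind)).mono (by grind),
              (h2.update_some (by grind)).mono (by grind)⟩
      · refine ⟨Function.update f b (some x), Function.update g b (some i), ?_,
          Or.inr ⟨x, hxB, hxA, hf1.update_some (by grind), hg1.update_some hiB'⟩⟩
        rw [matchValue_update w hb, matchValue_update w hb, matchValue_erase w hb f,
          matchValue_erase w hb g, hfb, hgb]
        simp only [Option.elim_some]
        ring
  · refine ⟨f, g, rfl, Or.inl ⟨⟨fun b hb x hx => Finset.mem_erase.2 ⟨?_, hf.mem b hb x hx⟩,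
      hf.inj⟩, hg.mono (Finset.subset_insert _ _)⟩⟩
    rintro rfl
    exact h ⟨b, hb, hx⟩

/-- `v` is the maximum weight matching valuation of the weights `w`. -/
structure IsAssignment [Fintype ι] (w : ι → X → ℝ) (v : ItemValuation X) : Prop where
  le : ∀ S f, IsMatching Finset.univ f S → matchValue w Finset.univ f ≤ v S
  exists_eq : ∀ S, ∃ f, IsMatching Finset.univ f S ∧ v S = matchValue w Finset.univ f

theorem IsAssignment.hasExchange [Fintype ι] {w : ι → X → ℝ} {v : ItemValuation X}
    (h : IsAssignment w v) : HasExchange v := by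
  intro A B i hiA hiB
  obtain ⟨f, hf, hfv⟩ := h.exists_eq A
  obtain ⟨g, hg, hgv⟩ := h.exists_eq B
  obtain ⟨f', g', hval, hm⟩ := IsMatching.exchange w Finset.univ f g A B i hf hg hiA hiB
  rw [hfv, hgv, hval]
  rcases hm with ⟨h1, h2⟩ | ⟨j, hjB, hjA, h1, h2⟩
  · exact Or.inl (add_le_add (h.le _ _ h1) (h.le _ _ h2))
  · exact Or.inr ⟨j, hjB, hjA, add_le_add (h.le _ _ h1) (h.le _ _ h2)⟩

theorem IsAssignment.or {κ : Type*} [DecidableEq κ] [Fintype ι] [Fintype κ] {w : ι → X → ℝ}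
    {u : κ → X → ℝ} {v₁ v₂ : ItemValuation X} (h₁ : IsAssignment w v₁) (h₂ : IsAssignment u v₂) :
    IsAssignment (Sum.elim w u) (orVal v₁ v₂) := by
  have hsum : ∀ f : ι ⊕ κ → Option X, matchValue (Sum.elim w u) Finset.univ f =
      matchValue w Finset.univ (f ∘ Sum.inl) + matchValue u Finset.univ (f ∘ Sum.inr) := by
    intro f
    simp [matchValue]
  constructor
  · intro S f hf
    -- The split of `S` gives the left bidders exactly the items they are matched to.
    have hT : S.filter (fun x => ∃ b, f (Sum.inl b) = some x) ∈ S.powerset := by simp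
    refine le_trans ?_ (Finset.le_sup' (fun T => v₁ T + v₂ (S \ T)) hT)
    rw [hsum]
    refine add_le_add (h₁.le _ _ ⟨fun b _ x hx => ?_, fun b _ c _ x hb hc => ?_⟩)
      (h₂.le _ _ ⟨fun b _ x hx => ?_, fun b _ c _ x hb hc => ?_⟩)
    · exact Finset.mem_filter.2 ⟨hf.mem _ (Finset.mem_univ _) x hx, b, hx⟩
    · exact Sum.inl_injective (hf.inj _ (Finset.mem_univ _) _ (Finset.mem_univ _) x hb hc)
    · refine Finset.mem_sdiff.2 ⟨hf.mem _ (Finset.mem_univ _) x hx, fun h => ?_⟩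
      obtain ⟨-, c, hc⟩ := Finset.mem_filter.1 h
      exact Sum.inl_ne_inr (hf.inj _ (Finset.mem_univ _) _ (Finset.mem_univ _) x hc hx)
    · exact Sum.inr_injective (hf.inj _ (Finset.mem_univ _) _ (Finset.mem_univ _) x hb hc)
  · intro S
    obtain ⟨T, hT, hTv⟩ := Finset.exists_mem_eq_sup' ⟨∅, Finset.empty_mem_powerset S⟩
      (fun T => v₁ T + v₂ (S \ T))
    obtain ⟨f, hf, hfv⟩ := h₁.exists_eq T
    obtain ⟨g, hg, hgv⟩ := h₂.exists_eq (S \ T)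
    have hdisj : ∀ b c x, f b = some x → g c = some x → False := fun b c x hb hc =>
      (Finset.mem_sdiff.1 (hg.mem c (Finset.mem_univ _) x hc)).2 (hf.mem b (Finset.mem_univ _) x hb)
    refine ⟨Sum.elim f g, ⟨?_, ?_⟩, ?_⟩
    · rintro (b | b) - x hx
      · exact Finset.mem_powerset.1 hT (hf.mem b (Finset.mem_univ _) x hx)
      · exact (Finset.mem_sdiff.1 (hg.mem b (Finset.mem_univ _) x hx)).1
    · rintro (b | b) - (c | c) - x hb hc
      · rw [hf.inj b (Finset.mem_univ _) c (Finset.mem_univ _) x hb hc]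
      · exact (hdisj b c x hb hc).elim
      · exact (hdisj c b x hc hb).elim
      · rw [hg.inj b (Finset.mem_univ _) c (Finset.mem_univ _) x hb hc]
    · rw [hsum, Sum.elim_comp_inl, Sum.elim_comp_inr, ← hfv, ← hgv]
      exact hTv

/-- An XOR of singletons is unit-demand: `w x` is the largest price offered for `x`, and 0 if there
is none. The alternative `v S = 0` is needed for the empty set. -/
theorem exists_weights_of_mem_XS {v : ItemValuation X} (hv : v ∈ XS X) :
    ∃ w : X → ℝ, ∀ S, (∀ x ∈ S, w x ≤ v S) ∧ (v S = 0 ∨ ∃ x ∈ S, v S = w x) := by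
  induction hv with
  | base v hv =>
    obtain ⟨x, p, hp, rfl⟩ := hv
    refine ⟨fun y => if y = x then p else 0, fun S => ?_⟩
    by_cases hx : x ∈ S
    · refine ⟨fun y _ => ?_, Or.inr ⟨x, hx, by simp [single, hx]⟩⟩
      by_cases hy : y = x <;> simp [single, hx, hy, hp]
    · refine ⟨fun y hy => ?_, Or.inl (by simp [single, hx])⟩
      have : y ≠ x := fun h => hx (h ▸ hy)
      simp [single, hx, this]
  | xor v₁ v₂ _ _ ih₁ ih₂ =>
    obtain ⟨w₁, h₁⟩ := ih₁
    obtain ⟨w₂, h₂⟩ := ih₂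
    refine ⟨fun x => max (w₁ x) (w₂ x), fun S =>
      ⟨fun x hx => max_le_max ((h₁ S).1 x hx) ((h₂ S).1 x hx), ?_⟩⟩
    change max (v₁ S) (v₂ S) = 0 ∨ ∃ x ∈ S, max (v₁ S) (v₂ S) = max (w₁ x) (w₂ x)
    have key : ∀ x ∈ S, max (w₁ x) (w₂ x) ≤ max (v₁ S) (v₂ S) :=
      fun x hx => max_le_max ((h₁ S).1 x hx) ((h₂ S).1 x hx)
    rcases le_total (v₁ S) (v₂ S) with h | h
    · rw [max_eq_right h] at key ⊢
      refine (h₂ S).2.imp id fun ⟨x, hx, hxv⟩ => ⟨x, hx, le_antisymm ?_ (key x hx)⟩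
      exact hxv.trans_le (le_max_right _ _)
    · rw [max_eq_left h] at key ⊢
      refine (h₁ S).2.imp id fun ⟨x, hx, hxv⟩ => ⟨x, hx, le_antisymm ?_ (key x hx)⟩
      exact hxv.trans_le (le_max_left _ _)

theorem exists_isAssignment_of_mem_OXS {v : ItemValuation X} (hv : v ∈ OXS X) :
    ∃ (ι : Type) (_ : DecidableEq ι) (_ : Fintype ι) (w : ι → X → ℝ), IsAssignment w v := by
  induction hv with
  | base v hv =>
    obtain ⟨w, hw⟩ := exists_weights_of_mem_XS hv
    refine ⟨Unit, inferInstance, inferInstance, fun _ => w, ⟨fun S f hf => ?_, fun S => ?_⟩⟩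
    · cases h : f () with
      | none => simp [matchValue, h, v.nonneg]
      | some x => simpa [matchValue, h] using (hw S).1 x (hf.mem () (Finset.mem_univ _) x h)
    · rcases (hw S).2 with h | ⟨x, hx, h⟩
      · exact ⟨fun _ => none, ⟨by simp, by simp⟩, by simp [matchValue, h]⟩
      · exact ⟨fun _ => some x, ⟨by simp [hx], by simp⟩, by simp [matchValue, h]⟩
  | or v₁ v₂ _ _ ih₁ ih₂ =>
    obtain ⟨ι, _, _, w, hw⟩ := ih₁
    obtain ⟨κ, _, _, u, hu⟩ := ih₂
    exact ⟨ι ⊕ κ, inferInstance, inferInstance, Sum.elim w u, hw.or hu⟩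

theorem OXS_subset_GS [Fintype X] : OXS X ⊆ GS X := by
  intro v hv
  obtain ⟨ι, _, _, w, hw⟩ := exists_isAssignment_of_mem_OXS hv
  exact hw.hasExchange.mem_GS

theorem IsAssignment.exists_weight_eq [Fintype ι] {w : ι → X → ℝ} {v : ItemValuation X}
    (h : IsAssignment w v) {x : X} (hx : v {x} ≠ 0) : ∃ b, v {x} = w b x := by
  obtain ⟨f, hf, hfv⟩ := h.exists_eq {x}
  obtain ⟨b, -, hb⟩ := Finset.exists_ne_zero_of_sum_ne_zero (hfv ▸ hx)
  have hfb : f b = some x := by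
    cases hb' : f b with
    | none => simp [hb'] at hb
    | some y => rw [Finset.mem_singleton.1 (hf.mem b (Finset.mem_univ _) y hb')]
  refine ⟨b, hfv.trans ?_⟩
  unfold matchValue
  rw [Finset.sum_eq_single b, hfb, Option.elim_some]
  · intro c _ hcb
    cases hc : f c with
    | none => rfl
    | some y =>
      have := Finset.mem_singleton.1 (hf.mem c (Finset.mem_univ _) y hc)
      subst this
      exact absurd (hf.inj c (Finset.mem_univ _) b (Finset.mem_univ _) y hc hfb) hcb
  · simp

theorem matchValue_pair [Fintype ι] (w : ι → X → ℝ) {f : ι → Option X} {x y : X} {b c : ι}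
    (hf : IsMatching Finset.univ f {x, y}) (hfb : f b = some x) (hfc : f c = some y) (hbc : b ≠ c) :
    matchValue w Finset.univ f = w b x + w c y := by
  unfold matchValue
  rw [Finset.sum_eq_add b c hbc, hfb, hfc, Option.elim_some, Option.elim_some]
  · rintro d - ⟨hdb, hdc⟩
    cases hd : f d with
    | none => rfl
    | some z =>
      have := hf.mem d (Finset.mem_univ _) z hd
      rw [Finset.mem_insert, Finset.mem_singleton] at this
      rcases this with rfl | rfl
      · exact absurd (hf.inj d (Finset.mem_univ _) b (Finset.mem_univ _) z hd hfb) hdb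
      · exact absurd (hf.inj d (Finset.mem_univ _) c (Finset.mem_univ _) z hd hfc) hdc
  · simp
  · simp

theorem IsAssignment.add_le_pair [Fintype ι] {w : ι → X → ℝ} {v : ItemValuation X}
    (h : IsAssignment w v) {x y : X} (hxy : x ≠ y) {b c : ι} (hbc : b ≠ c) :
    w b x + w c y ≤ v {x, y} := by
  have h0 : IsMatching (Finset.univ.erase b |>.erase c) (fun _ : ι => (none : Option X)) ∅ :=
    ⟨by simp, by simp⟩
  have h1 := (h0.update_some (Finset.notMem_empty y)).update_some (x := x) (by simpa using hxy)
  refine le_of_eq_of_le ?_ (h.le _ _ h1)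
  exact (matchValue_pair w h1 (by simp) (by simp [Function.update_of_ne hbc.symm]) hbc).symm

/-- The strict inequalities force an optimal matching to use both items: otherwise it would already
be a matching into one of the singletons. -/
theorem IsAssignment.exists_pair_eq [Fintype ι] {w : ι → X → ℝ} {v : ItemValuation X}
    (h : IsAssignment w v) {x y : X} (hxy : x ≠ y) (hx : v {x} < v {x, y})
    (hy : v {y} < v {x, y}) : ∃ b c, b ≠ c ∧ v {x, y} = w b x + w c y := by
  obtain ⟨f, hf, hfv⟩ := h.exists_eq {x, y}
  have hb : ∃ b, f b = some x := by
    by_contra! hcon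
    refine absurd (h.le {y} f ⟨fun b hb z hz => ?_, hf.inj⟩) (not_le.2 (hfv ▸ hy))
    have := hf.mem b hb z hz
    grind
  have hc : ∃ c, f c = some y := by
    by_contra! hcon
    refine absurd (h.le {x} f ⟨fun b hb z hz => ?_, hf.inj⟩) (not_le.2 (hfv ▸ hx))
    have := hf.mem b hb z hz
    grind
  obtain ⟨b, hb⟩ := hb
  obtain ⟨c, hc⟩ := hc
  have hbc : b ≠ c := by
    rintro rfl
    exact hxy (Option.some.inj (hb.symm.trans hc))
  exact ⟨b, c, hbc, hfv.trans (matchValue_pair w hf hb hc hbc)⟩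

/-- Let `β` be a bidder with weight 10 on `a`. Two different bidders with weight 10 on `a` and on
`x` would make `{a, x}` worth 20, so `β` also has weight 10 on `b`, `c`, `d`. The pairs worth 15
then leave every other bidder at most 5 on `a` and on `b`, so `{a, b}` is worth at most 15, not 19.
-/
theorem notMem_OXS_of_values {v : ItemValuation X} {a b c d : X} (hab : a ≠ b) (hac : a ≠ c)
    (had : a ≠ d) (hbd : b ≠ d) (ha : v {a} = 10) (hb : v {b} = 10)
    (hc : v {c} = 10) (hd : v {d} = 10) (vab : v {a, b} = 19)
    (vad : v {a, d} = 19) (vac : v {a, c} = 15) (vbd : v {b, d} = 15) : v ∉ OXS X := by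
  intro hv
  obtain ⟨ι, _, _, w, h⟩ := exists_isAssignment_of_mem_OXS hv
  obtain ⟨β, hβ⟩ := h.exists_weight_eq (x := a) (by rw [ha]; norm_num)
  have key : ∀ x, a ≠ x → v {x} = 10 → v {a, x} ≤ 19 → w β x = 10 := by
    intro x hax hx hvx
    obtain ⟨γ, hγ⟩ := h.exists_weight_eq (x := x) (by rw [hx]; norm_num)
    by_cases hβγ : β = γ
    · rw [hβγ, ← hγ, hx]
    · have := h.add_le_pair hax hβγ
      linarith
  have wb := key b hab hb (by linarith)
  have wc := key c hac hc (by linarith)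
  have wd := key d had hd (by linarith)
  obtain ⟨γ, δ, hne, hval⟩ := h.exists_pair_eq hab (by linarith) (by linarith)
  have bound : ∀ x z γ, x ≠ z → γ ≠ β → w β z = 10 → v {x, z} = 15 → w γ x ≤ 5 := by
    intro x z γ hxz hγ hz hvx
    have := h.add_le_pair hxz hγ
    linarith
  have ba : ∀ γ, γ ≠ β → w γ a ≤ 5 := fun γ hγ => bound a c γ hac hγ wc vac
  have bb : ∀ γ, γ ≠ β → w γ b ≤ 5 := fun γ hγ => bound b d γ hbd hγ wd vbd
  by_cases h1 : γ = β
  · subst h1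
    have := bb δ hne.symm
    linarith
  · have h2 := ba γ h1
    by_cases h3 : δ = β
    · subst h3
      linarith
    · have := bb δ h3
      linarith

end Matching

/-! ### Local submodularity and `GS ⊆ SM` -/

section Submodular

variable {X : Type*} [DecidableEq X]

theorem mem_SM_of_pairwise {v : ItemValuation X}
    (h : ∀ (S : Finset X) (x y : X), x ∉ S → y ∉ S → x ≠ y →
      v (insert x (insert y S)) + v S ≤ v (insert x S) + v (insert y S)) : v ∈ SM X := by
  have key : ∀ (x : X) (S U : Finset X), x ∉ S → x ∉ U →
      v (insert x (S ∪ U)) - v (S ∪ U) ≤ v (insert x S) - v S := by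
    intro x S U hS
    induction U using Finset.induction with
    | empty => simp
    | insert y U hy ih =>
      intro hxU
      have hxy : x ≠ y := fun h => hxU (h ▸ Finset.mem_insert_self _ _)
      have hxU' : x ∉ U := fun h => hxU (Finset.mem_insert_of_mem h)
      have ih' := ih hxU'
      rw [Finset.union_insert]
      by_cases hyS : y ∈ S ∪ U
      · rwa [Finset.insert_eq_of_mem hyS]
      · have := h (S ∪ U) x y (by simp [hS, hxU']) hyS hxy
        linarith
  intro S T hST x
  simp only [marginal, Finset.singleton_union]
  by_cases hxT : x ∈ T
  · rw [Finset.insert_eq_of_mem hxT, sub_self, sub_nonneg]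
    exact v.mono' _ _ (Finset.subset_insert _ _)
  · have := key x S T (fun h => hxT (hST h)) hxT
    rwa [Finset.union_eq_right.2 hST] at this

theorem mem_of_mem_demand_of_neg {v : ItemValuation X} {p : X → ℝ} {A : Finset X}
    (hA : A ∈ demand v p) {z : X} (hz : p z < 0) : z ∈ A := by
  by_contra h
  have h1 := hA (insert z A)
  have h2 := v.mono' _ _ (Finset.subset_insert z A)
  simp only [surplus, Finset.sum_insert h] at h1
  linarith

theorem notMem_of_mem_demand [Fintype X] {v : ItemValuation X} {p : X → ℝ} {A : Finset X}
    (hA : A ∈ demand v p) {z : X} (hz : v Finset.univ < p z) : z ∉ A := by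
  intro h
  have h1 := hA (A.erase z)
  have h2 := v.mono' _ _ (Finset.subset_univ A)
  have h3 := v.nonneg (A.erase z)
  have h4 := Finset.add_sum_erase A p h
  simp only [surplus] at h1
  linarith

/-- Prices at which `F` is bought, every item outside `F ∪ {x}` is too expensive, and `x` costs
`r`. -/
def forcingPrice [Fintype X] (v : ItemValuation X) (F : Finset X) (x : X) (r : ℝ) (z : X) : ℝ :=
  if z = x then r else if z ∈ F then -1 else v Finset.univ + 1

/-- By monotonicity an item at a negative price is always bought, and one dearer than the whole of
`X` never is. Only `x` remains to be decided. -/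
theorem erase_eq_of_mem_demand_forcingPrice [Fintype X] {v : ItemValuation X} {F : Finset X} {x : X}
    (hx : x ∉ F) {r : ℝ} {A : Finset X} (hA : A ∈ demand v (forcingPrice v F x r)) :
    A.erase x = F := by
  ext z
  rw [Finset.mem_erase]
  constructor
  · rintro ⟨hzx, hzA⟩
    by_contra hzF
    exact notMem_of_mem_demand hA (by simp [forcingPrice, hzx, hzF]) hzA
  · intro hzF
    have hzx : z ≠ x := fun h => hx (h ▸ hzF)
    exact ⟨hzx, mem_of_mem_demand_of_neg hA (by simp [forcingPrice, hzx, hzF])⟩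

theorem mem_demand_forcingPrice [Fintype X] {v : ItemValuation X} {F : Finset X} {x : X}
    (hx : x ∉ F) {r : ℝ} (hr : r < v (insert x F) - v F) {A : Finset X}
    (hA : A ∈ demand v (forcingPrice v F x r)) : x ∈ A := by
  by_contra h
  have hAF := erase_eq_of_mem_demand_forcingPrice hx hA
  rw [Finset.erase_eq_of_notMem h] at hAF
  subst hAF
  have h1 := hA (insert x A)
  simp only [surplus, Finset.sum_insert hx, forcingPrice, if_true] at h1
  linarith

theorem notMem_demand_forcingPrice [Fintype X] {v : ItemValuation X} {F : Finset X} {x : X}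
    (hx : x ∉ F) {r : ℝ} (hr : v (insert x F) - v F < r) {A : Finset X}
    (hA : A ∈ demand v (forcingPrice v F x r)) : x ∉ A := by
  intro h
  have hAF := erase_eq_of_mem_demand_forcingPrice hx hA
  have h1 := hA F
  rw [← Finset.insert_erase h, hAF] at h1
  simp only [surplus, Finset.sum_insert hx, forcingPrice, if_true] at h1
  linarith

theorem GS_subset_SM [Fintype X] : GS X ⊆ SM X := by
  intro v hv
  refine mem_SM_of_pairwise fun S x y hxS hyS hxy => ?_
  by_contra! hlt
  have hxyS : x ∉ insert y S := by simp [hxy, hxS]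
  -- At price `r`, `x` is bought on top of `insert y S` but not on top of `S`. Passing between the
  -- two forcing prices raises only the price of `y`, so gross substitutes is violated.
  obtain ⟨r, hr1, hr2⟩ := exists_between
    (show v (insert x S) - v S < v (insert x (insert y S)) - v (insert y S) by linarith)
  obtain ⟨A, hA⟩ := demand_nonempty v (forcingPrice v (insert y S) x r)
  have hle : forcingPrice v (insert y S) x r ≤ forcingPrice v S x r := by
    intro z
    have := v.nonneg Finset.univ
    unfold forcingPrice
    by_cases h1 : z = x
    · simp [h1]
    · by_cases h2 : z ∈ S
      · simp [h1, h2]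
      · simp only [h1, h2, if_false, Finset.mem_insert, or_false]
        split_ifs <;> linarith
  obtain ⟨A', hA', hxA'⟩ := hv x _ _ hle (by simp [forcingPrice]) A hA
    (mem_demand_forcingPrice hxyS hr2 hA)
  exact notMem_demand_forcingPrice hxS hr1 hA' hxA'

end Submodular

/-! ### Supporting additive valuations and `SM ⊆ XOS ⊆ CF` -/

section Supporting

variable {X : Type*} [DecidableEq X]

/-- An optimal split gives each item to the side with the larger weight. -/
theorem orVal_apply_of_additive {v₁ v₂ : ItemValuation X} {w₁ w₂ : X → ℝ}
    (h₁ : ∀ S, v₁ S = ∑ x ∈ S, w₁ x) (h₂ : ∀ S, v₂ S = ∑ x ∈ S, w₂ x) (S : Finset X) :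
    orVal v₁ v₂ S = ∑ x ∈ S, max (w₁ x) (w₂ x) := by
  change S.powerset.sup' ⟨∅, Finset.empty_mem_powerset S⟩ (fun T => v₁ T + v₂ (S \ T)) = _
  apply le_antisymm
  · refine Finset.sup'_le _ _ fun T hT => ?_
    rw [h₁, h₂, ← Finset.sum_sdiff (Finset.mem_powerset.1 hT), add_comm]
    exact add_le_add (Finset.sum_le_sum fun x _ => le_max_right _ _)
      (Finset.sum_le_sum fun x _ => le_max_left _ _)
  · have hT : S.filter (fun x => w₂ x ≤ w₁ x) ∈ S.powerset := by simp
    refine le_trans (le_of_eq ?_) (Finset.le_sup' (fun T => v₁ T + v₂ (S \ T)) hT)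
    rw [h₁, h₂, ← Finset.sum_sdiff (Finset.mem_powerset.1 hT), add_comm]
    congr 1
    · exact Finset.sum_congr rfl fun x hx => max_eq_left (Finset.mem_filter.1 hx).2
    · refine Finset.sum_congr rfl fun x hx => max_eq_right ?_
      grind

theorem single_apply_eq_sum (x : X) (p : ℝ) (hp : 0 ≤ p) (S : Finset X) :
    single x p hp S = ∑ y ∈ S, if y = x then p else 0 := by
  simp [single]

theorem exists_additive_of_mem_OS {v : ItemValuation X} (hv : v ∈ OS X) :
    ∃ w : X → ℝ, (∀ x, 0 ≤ w x) ∧ ∀ S, v S = ∑ x ∈ S, w x := by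
  induction hv with
  | base v hv =>
    obtain ⟨x, p, hp, rfl⟩ := hv
    refine ⟨fun y => if y = x then p else 0, fun y => ?_, single_apply_eq_sum x p hp⟩
    dsimp only
    split_ifs <;> simp [hp]
  | or v₁ v₂ _ _ ih₁ ih₂ =>
    obtain ⟨w₁, h₁, h₁'⟩ := ih₁
    obtain ⟨w₂, h₂, h₂'⟩ := ih₂
    exact ⟨fun x => max (w₁ x) (w₂ x), fun x => le_max_of_le_left (h₁ x),
      orVal_apply_of_additive h₁' h₂'⟩

theorem exists_mem_OS_of_weights [Fintype X] [Nonempty X] {w : X → ℝ} (hw : ∀ x, 0 ≤ w x) :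
    ∃ v ∈ OS X, ∀ S, v S = ∑ x ∈ S, w x := by
  have key : ∀ F : Finset X, F.Nonempty →
      ∃ v ∈ OS X, ∀ S, v S = ∑ x ∈ S, if x ∈ F then w x else 0 := by
    intro F hF
    induction hF using Finset.Nonempty.cons_induction with
    | singleton x =>
      refine ⟨single x (w x) (hw x), OrsOf.base _ ⟨x, w x, hw x, rfl⟩, fun S => ?_⟩
      rw [single_apply_eq_sum]
      refine Finset.sum_congr rfl fun y _ => ?_
      by_cases h : y = x <;> simp [h]
    | cons x F hx hF ih =>
      obtain ⟨v, hv, hv'⟩ := ih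
      refine ⟨orVal (single x (w x) (hw x)) v, OrsOf.or _ _ (OrsOf.base _ ⟨x, w x, hw x, rfl⟩) hv,
        fun S => ?_⟩
      rw [orVal_apply_of_additive (single_apply_eq_sum x (w x) (hw x)) hv']
      refine Finset.sum_congr rfl fun y _ => ?_
      by_cases h : y = x
      · subst h
        simp [hx, hw]
      · by_cases h' : y ∈ F <;> simp [h, h', hw]
  obtain ⟨v, hv, hv'⟩ := key Finset.univ Finset.univ_nonempty
  exact ⟨v, hv, fun S => by simp [hv']⟩

/-- Every set has a supporting non-negative additive valuation. -/
def HasSupports (v : ItemValuation X) : Prop :=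
  ∀ S : Finset X, ∃ w : X → ℝ, (∀ x, 0 ≤ w x) ∧ v S = ∑ x ∈ S, w x ∧ ∀ T, ∑ x ∈ T, w x ≤ v T

theorem hasSupports_of_mem_XOS {v : ItemValuation X} (hv : v ∈ XOS X) : HasSupports v := by
  induction hv with
  | base v hv =>
    obtain ⟨w, hw, hv'⟩ := exists_additive_of_mem_OS hv
    exact fun S => ⟨w, hw, hv' S, fun T => (hv' T).ge⟩
  | xor v₁ v₂ _ _ ih₁ ih₂ =>
    intro S
    change ∃ w : X → ℝ, (∀ x, 0 ≤ w x) ∧ max (v₁ S) (v₂ S) = ∑ x ∈ S, w x ∧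
      ∀ T, ∑ x ∈ T, w x ≤ max (v₁ T) (v₂ T)
    rcases le_total (v₁ S) (v₂ S) with h | h
    · obtain ⟨w, hw, hS, hT⟩ := ih₂ S
      exact ⟨w, hw, (max_eq_right h).trans hS, fun T => (hT T).trans (le_max_right _ _)⟩
    · obtain ⟨w, hw, hS, hT⟩ := ih₁ S
      exact ⟨w, hw, (max_eq_left h).trans hS, fun T => (hT T).trans (le_max_left _ _)⟩

/-- The XOR of one support for each set lies below `v` everywhere and reaches `v S` through the
support of `S`. -/
theorem HasSupports.mem_XOS [Fintype X] [Nonempty X] {v : ItemValuation X} (hv : HasSupports v) :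
    v ∈ XOS X := by
  have key : ∀ F : Finset (Finset X), F.Nonempty →
      ∃ u ∈ XOS X, (∀ T, u T ≤ v T) ∧ ∀ S ∈ F, v S ≤ u S := by
    intro F hF
    induction hF using Finset.Nonempty.cons_induction with
    | singleton S =>
      obtain ⟨w, hw, hS, hT⟩ := hv S
      obtain ⟨u, hu, hu'⟩ := exists_mem_OS_of_weights hw
      refine ⟨u, XorsOf.base u hu, fun T => (hu' T).trans_le (hT T), fun T hTS => ?_⟩
      rw [Finset.mem_singleton.1 hTS, hS, hu']
    | cons S F hSF hF ih =>
      obtain ⟨u₁, hu₁, hle, hge⟩ := ih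
      obtain ⟨w, hw, hS, hT⟩ := hv S
      obtain ⟨u, hu, hu'⟩ := exists_mem_OS_of_weights hw
      refine ⟨xorVal u u₁, XorsOf.xor _ _ (XorsOf.base u hu) hu₁,
        fun T => max_le ((hu' T).trans_le (hT T)) (hle T), fun T hTS => ?_⟩
      rcases Finset.mem_cons.1 hTS with rfl | hTF
      · exact (hS.trans (hu' T).symm).le.trans (le_max_left _ _)
      · exact (hge T hTF).trans (le_max_right _ _)
  obtain ⟨u, hu, hle, hge⟩ := key Finset.univ Finset.univ_nonempty
  have : v = u := by
    ext S
    exact le_antisymm (hge S (Finset.mem_univ S)) (hle S)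
  exact this ▸ hu

theorem XOS_subset_CF : XOS X ⊆ CF X := by
  intro v hv A B
  obtain ⟨w, hw, hS, hT⟩ := hasSupports_of_mem_XOS hv (A ∪ B)
  have h := Finset.sum_union_inter (s₁ := A) (s₂ := B) (f := w)
  have h0 : 0 ≤ ∑ x ∈ A ∩ B, w x := Finset.sum_nonneg fun x _ => hw x
  linarith [hT A, hT B]

theorem hasSupports_of_mem_SM {v : ItemValuation X} (hv : v ∈ SM X) : HasSupports v := by
  intro S
  -- The vanishing of `w` off `S` reduces an arbitrary `T` to `T ∩ S` at the end.
  have key : ∃ w : X → ℝ, (∀ x, 0 ≤ w x) ∧ (∀ x ∉ S, w x = 0) ∧ v S = ∑ x ∈ S, w x ∧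
      ∀ T ⊆ S, ∑ x ∈ T, w x ≤ v T := by
    induction S using Finset.induction with
    | empty =>
      refine ⟨fun _ => 0, fun _ => le_rfl, fun _ _ => rfl, by simp [v.map_empty'], fun T _ => ?_⟩
      simp [v.nonneg]
    | insert x S hx ih =>
      obtain ⟨w, hw, hw0, hS, hT⟩ := ih
      have hcongr : ∀ (m : ℝ) (T : Finset X), x ∉ T →
          ∑ y ∈ T, Function.update w x m y = ∑ y ∈ T, w y := fun m T hxT =>
        Finset.sum_congr rfl fun y hy =>
          Function.update_of_ne (ne_of_mem_of_not_mem hy hxT) _ _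
      -- The greedy weight of the new item is its marginal over `S`; by submodularity this is at
      -- most its marginal over `T.erase x ⊆ S`.
      refine ⟨Function.update w x (v (insert x S) - v S), fun y => ?_, fun y hy => ?_, ?_,
        fun T hTS => ?_⟩
      · by_cases hy : y = x
        · subst hy
          rw [Function.update_self, sub_nonneg]
          exact v.mono' _ _ (Finset.subset_insert _ _)
        · rw [Function.update_of_ne hy]
          exact hw y
      · rw [Finset.mem_insert, not_or] at hy
        rw [Function.update_of_ne hy.1]
        exact hw0 y hy.2
      · rw [Finset.sum_insert hx, hcongr _ _ hx, Function.update_self, ← hS]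
        ring
      · by_cases hxT : x ∈ T
        · have hsub : T.erase x ⊆ S := Finset.subset_insert_iff.1 hTS
          have h1 := hv _ _ hsub x
          simp only [marginal, Finset.singleton_union, Finset.insert_erase hxT] at h1
          rw [← Finset.add_sum_erase T _ hxT, hcongr _ _ (Finset.notMem_erase x T),
            Function.update_self]
          linarith [hT _ hsub]
        · rw [hcongr _ _ hxT]
          exact hT T ((Finset.subset_insert_iff_of_notMem hxT).1 hTS)
  obtain ⟨w, hw, hw0, hS, hT⟩ := key
  refine ⟨w, hw, hS, fun T => ?_⟩
  have h1 : ∑ x ∈ T ∩ S, w x = ∑ x ∈ T, w x :=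
    Finset.sum_subset Finset.inter_subset_left fun x hxT hx => hw0 x fun hxS =>
      hx (Finset.mem_inter.2 ⟨hxT, hxS⟩)
  rw [← h1]
  exact (hT _ Finset.inter_subset_right).trans (v.mono' _ _ Finset.inter_subset_left)

theorem SM_subset_XOS [Fintype X] [Nonempty X] : SM X ⊆ XOS X :=
  fun _ hv => (hasSupports_of_mem_SM hv).mem_XOS

end Supporting

/-! ### Adding worthless items -/

section Extension

variable {α X : Type*} [DecidableEq X]

/-- The valuation on `X` that only counts the items in the range of `e`. -/
noncomputable def extend (e : α ↪ X) (v : ItemValuation α) : ItemValuation X where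
  toFun S := v (S.preimage e e.injective.injOn)
  map_empty' := by simp [v.map_empty']
  mono' A B h := v.mono' _ _ (Finset.monotone_preimage e.injective h)

theorem extend_apply (e : α ↪ X) (v : ItemValuation α) (S : Finset X) :
    extend e v S = v (S.preimage e e.injective.injOn) := rfl

theorem extend_map (e : α ↪ X) (v : ItemValuation α) (S : Finset α) :
    extend e v (S.map e) = v S := by
  rw [extend_apply]
  congr 1
  ext x
  simp

variable [DecidableEq α]

theorem HasExchange.extend {e : α ↪ X} {v : ItemValuation α} (hv : HasExchange v) :
    HasExchange (extend e v) := by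
  intro A B i hiA hiB
  by_cases hi : ∃ a, e a = i
  · obtain ⟨a, rfl⟩ := hi
    have herase : ∀ (S : Finset X) (a : α), (S.erase (e a)).preimage e e.injective.injOn =
        (S.preimage e e.injective.injOn).erase a := by
      intro S a
      ext x
      simp
    have hinsert : ∀ (S : Finset X) (a : α), (insert (e a) S).preimage e e.injective.injOn =
        insert a (S.preimage e e.injective.injOn) := by
      intro S a
      ext x
      simp
    rcases hv (A.preimage e e.injective.injOn) (B.preimage e e.injective.injOn) a (by simpa)
      (by simpa) with h | ⟨j, hjB, hjA, h⟩
    · left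
      simpa only [extend_apply, herase, hinsert] using h
    · refine Or.inr ⟨e j, by simpa using hjB, by simpa using hjA, ?_⟩
      simpa only [extend_apply, herase, hinsert] using h
  -- A worthless `i` leaves `A` at no loss, and adding it to `B` does no harm.
  · left
    refine add_le_add (le_of_eq ?_)
      ((CombinatorialAuction.extend e v).mono' _ _ (Finset.subset_insert _ _))
    rw [extend_apply, extend_apply]
    congr 1
    ext x
    have : e x ≠ i := fun h => hi ⟨x, h⟩
    simp [this]

theorem extend_mem_CF {e : α ↪ X} {v : ItemValuation α} (hv : v ∈ CF α) : extend e v ∈ CF X := by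
  intro A B
  have h := hv (A.preimage e e.injective.injOn) (B.preimage e e.injective.injOn)
  rw [extend_apply, Finset.preimage_union]
  exact h

theorem extend_mem_SM {e : α ↪ X} {v : ItemValuation α} (hv : v ∈ SM α) : extend e v ∈ SM X := by
  intro S T hST x
  by_cases hx : ∃ a, e a = x
  · obtain ⟨a, rfl⟩ := hx
    have h := hv _ _ (Finset.monotone_preimage e.injective hST) a
    have hinsert : ∀ S : Finset X, (insert (e a) S).preimage e e.injective.injOn =
        insert a (S.preimage e e.injective.injOn) := by
      intro S
      ext x
      simp
    simpa only [marginal, Finset.singleton_union, extend_apply, hinsert] using h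
  · have hinsert : ∀ S : Finset X, (insert x S).preimage e e.injective.injOn =
        S.preimage e e.injective.injOn := by
      intro S
      ext y
      have : e y ≠ x := fun h => hx ⟨y, h⟩
      simp [this]
    simp only [marginal, Finset.singleton_union, extend_apply, hinsert, sub_self, le_refl]

theorem mem_SM_of_extend {e : α ↪ X} {v : ItemValuation α} (hv : extend e v ∈ SM X) :
    v ∈ SM α := by
  intro S T hST x
  have h := hv (S.map e) (T.map e) (Finset.map_subset_map.2 hST) (e x)
  simpa only [marginal, Finset.singleton_union, ← Finset.map_insert, extend_map] using h

theorem HasSupports.of_extend {e : α ↪ X} {v : ItemValuation α} (hv : HasSupports (extend e v)) :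
    HasSupports v := by
  intro S
  obtain ⟨w, hw, hS, hT⟩ := hv (S.map e)
  refine ⟨w ∘ e, fun x => hw _, ?_, fun T => ?_⟩
  · rw [← extend_map e v, hS, Finset.sum_map]
    rfl
  · have := hT (T.map e)
    rwa [extend_map, Finset.sum_map] at this

theorem HasSupports.extend {e : α ↪ X} {v : ItemValuation α} (hv : HasSupports v) :
    HasSupports (extend e v) := by
  intro S
  obtain ⟨w, hw, hS, hT⟩ := hv (S.preimage e e.injective.injOn)
  have hsum : ∀ T : Finset X, ∑ x ∈ T, Function.extend e w 0 x =
      ∑ a ∈ T.preimage e e.injective.injOn, w a := by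
    intro T
    rw [← Finset.sum_preimage e T e.injective.injOn]
    · exact Finset.sum_congr rfl fun a _ => e.injective.extend_apply _ _ _
    · intro x _ hx
      exact Function.extend_apply' _ _ _ hx
  refine ⟨Function.extend e w 0, fun x => ?_, (hsum S).symm ▸ hS, fun T => (hsum T).symm ▸ hT _⟩
  by_cases hx : ∃ a, e a = x
  · obtain ⟨a, rfl⟩ := hx
    rw [e.injective.extend_apply]
    exact hw a
  · rw [Function.extend_apply' _ _ _ hx]
    rfl

theorem mem_GS_of_extend {e : α ↪ X} {v : ItemValuation α} (hv : extend e v ∈ GS X) :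
    v ∈ GS α := by
  intro i p q hpq hi A hA hiA
  -- Items outside the range of `e` get price 1; being worthless, they can be dropped without
  -- lowering the surplus.
  have hle : ∀ (p : α → ℝ) (T : Finset X), surplus (extend e v) (Function.extend e p 1) T ≤
      surplus v p (T.preimage e e.injective.injOn) := by
    intro p T
    refine sub_le_sub le_rfl ?_
    have hsub : (T.preimage e e.injective.injOn).map e ⊆ T := by
      intro x hx
      simp only [Finset.mem_map, Finset.mem_preimage] at hx
      obtain ⟨a, ha, rfl⟩ := hx
      exact ha
    have h1 : ∑ a ∈ T.preimage e e.injective.injOn, p a =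
        ∑ x ∈ (T.preimage e e.injective.injOn).map e, Function.extend e p 1 x := by
      rw [Finset.sum_map]
      exact Finset.sum_congr rfl fun a _ => (e.injective.extend_apply _ _ _).symm
    rw [h1]
    refine Finset.sum_le_sum_of_subset_of_nonneg hsub fun x hxT hx => ?_
    rw [Function.extend_apply']
    · exact zero_le_one
    · rintro ⟨a, rfl⟩
      exact hx (by simpa using hxT)
  have hmap : ∀ (p : α → ℝ) (T : Finset α),
      surplus (extend e v) (Function.extend e p 1) (T.map e) = surplus v p T := by
    intro p T
    rw [surplus, extend_map, Finset.sum_map, surplus]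
    congr 1
    exact Finset.sum_congr rfl fun a _ => e.injective.extend_apply _ _ _
  have hpq' : Function.extend e p 1 ≤ Function.extend e q 1 := by
    intro x
    by_cases hx : ∃ a, e a = x
    · obtain ⟨a, rfl⟩ := hx
      simpa only [e.injective.extend_apply] using hpq a
    · rw [Function.extend_apply' _ _ _ hx, Function.extend_apply' _ _ _ hx]
  obtain ⟨B, hB, hiB⟩ := hv (e i) _ _ hpq' (by simp only [e.injective.extend_apply, hi]) (A.map e)
    (fun T => (hle p T).trans ((hA _).trans (hmap p A).ge)) (by simpa using hiA)
  exact ⟨B.preimage e e.injective.injOn,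
    fun T => (hmap q T).ge.trans ((hB _).trans (hle q B)), by simpa using hiB⟩

end Extension

/-! ### The separating examples -/

section Examples

theorem fourItemExample_hasExchange : HasExchange fourItemExample := by
  intro A B i hiA hiB
  simp only [fourItemExample, ← Nat.cast_add, Nat.cast_le]
  revert A B i
  decide +kernel

theorem fourItemExample_extend_notMem_OXS {X : Type*} [DecidableEq X] (e : Fin 4 ↪ X) :
    extend e fourItemExample ∉ OXS X := by
  have hne : ∀ i j, i ≠ j → e i ≠ e j := fun i j h h' => h (e.injective h')
  have h1 : ∀ i : Fin 4, extend e fourItemExample {e i} = 10 := by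
    intro i
    rw [← Finset.map_singleton, extend_map]
    simp [fourItemExample]
  have h2 : ∀ i j : Fin 4, extend e fourItemExample {e i, e j} = fourItemExample {i, j} := by
    intro i j
    rw [← extend_map e, Finset.map_insert, Finset.map_singleton]
  have h3 : ∀ (S : Finset (Fin 4)) (n : ℕ), (if S = ∅ then 0 else if S.card = 1 then 10
      else if S = {0, 2} ∨ S = {1, 3} then 15 else 19) = n → fourItemExample S = n :=
    fun S n h => congrArg Nat.cast h
  exact notMem_OXS_of_values (hne 0 1 (by decide)) (hne 0 2 (by decide)) (hne 0 3 (by decide))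
    (hne 1 3 (by decide)) (h1 0) (h1 1) (h1 2) (h1 3)
    ((h2 0 1).trans (mod_cast h3 {0, 1} 19 (by decide)))
    ((h2 0 3).trans (mod_cast h3 {0, 3} 19 (by decide)))
    ((h2 0 2).trans (mod_cast h3 {0, 2} 15 (by decide)))
    ((h2 1 3).trans (mod_cast h3 {1, 3} 15 (by decide)))

theorem budgetExample_mem_SM : budgetExample ∈ SM (Fin 3) := by
  refine mem_SM_of_pairwise fun S x y hx hy hxy => ?_
  have hw : ∀ z, 0 ≤ (![2, 2, 4] : Fin 3 → ℝ) z := by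
    intro z
    fin_cases z <;> simp
  have hx' : x ∉ insert y S := by simp [hxy, hx]
  simp only [budgetExample, Finset.sum_insert hx, Finset.sum_insert hy, Finset.sum_insert hx']
  have h1 := hw x
  have h2 := hw y
  -- This is the concavity of `t ↦ min 4 t`, applied with the nonnegative increments `h1` and `h2`.
  grind

theorem budgetExample_notMem_GS : budgetExample ∉ GS (Fin 3) := by
  intro h
  have hsurplus : ∀ (p : Fin 3 → ℝ) (S : Finset (Fin 3)), surplus budgetExample p S =
      min 4 ((if 0 ∈ S then 2 else 0) + (if 1 ∈ S then 2 else 0) + (if 2 ∈ S then 4 else 0)) -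
      ((if 0 ∈ S then p 0 else 0) + (if 1 ∈ S then p 1 else 0) + (if 2 ∈ S then p 2 else 0)) := by
    intro p S
    have hs : ∀ f : Fin 3 → ℝ, ∑ i ∈ S, f i =
        (if 0 ∈ S then f 0 else 0) + (if 1 ∈ S then f 1 else 0) + (if 2 ∈ S then f 2 else 0) := by
      intro f
      rw [← Fin.sum_univ_three (fun i => if i ∈ S then f i else 0)]
      simp
    rw [surplus, hs]
    simp [budgetExample, hs]
  -- At the first prices `{0, 1}` and `{2}` tie with surplus 2. Once item 0 costs 3/2, every set
  -- containing item 1 has surplus at most 3/2, below that of `{2}`.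
  obtain ⟨A, hA, h1⟩ := h 1 ![1, 1, 2] ![3 / 2, 1, 2]
    (by intro i; fin_cases i <;> norm_num) (by simp) {0, 1}
    (by
      intro T
      rw [hsurplus, hsurplus]
      by_cases h0 : 0 ∈ T <;> by_cases h1 : 1 ∈ T <;> by_cases h2 : 2 ∈ T <;>
        simp [h0, h1, h2] <;> norm_num)
    (by simp)
  have h2 := hA {2}
  rw [hsurplus, hsurplus] at h2
  revert h2
  by_cases h0 : 0 ∈ A <;> by_cases h2 : 2 ∈ A <;> simp [h0, h1, h2] <;> norm_num

theorem xosExample_hasSupports : HasSupports xosExample := by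
  have hge : ∀ T : Finset (Fin 3), T.Nonempty → 2 ≤ xosExample T := by
    intro T hT
    change (2 : ℝ) ≤ ((_ : ℕ) : ℝ)
    exact_mod_cast (by
      have := hT.card_pos
      split_ifs <;> omega)
  intro S
  rcases S.eq_empty_or_nonempty with rfl | ⟨x, hx⟩
  · exact ⟨fun _ => 0, fun _ => le_rfl, by simp [xosExample.map_empty'],
      fun T => by simp [xosExample.nonneg]⟩
  · by_cases hS : S.card ≤ 2
    -- For `S` of size at most 2, all the weight sits on one item of `S`; the full set is supported
    -- by weights 1.
    · refine ⟨fun y => if y = x then 2 else 0, fun y => ?_, ?_, fun T => ?_⟩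
      · dsimp only
        split_ifs <;> norm_num
      · have : S ≠ ∅ := Finset.ne_empty_of_mem hx
        simp [xosExample, hx, hS, this]
      · by_cases hxT : x ∈ T
        · simpa [hxT] using hge T ⟨x, hxT⟩
        · simp [hxT, xosExample.nonneg]
    · have hval : xosExample S = 3 := by
        have : S.card ≠ 0 := by omega
        simp only [xosExample, this, hS, if_false]
        norm_num
      have hcard : ∀ T : Finset (Fin 3), T.card ≤ 3 := fun T => by
        simpa using Finset.card_le_univ T
      refine ⟨fun _ => 1, fun _ => zero_le_one, ?_, fun T => ?_⟩
      · have : S.card = 3 := le_antisymm (hcard S) (by omega)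
        simp [hval, this]
      · rw [Finset.sum_const, nsmul_one]
        change (T.card : ℝ) ≤ ((_ : ℕ) : ℝ)
        exact_mod_cast (by
          have := hcard T
          split_ifs <;> omega)

theorem xosExample_notMem_SM : xosExample ∉ SM (Fin 3) := by
  intro h
  have h1 := h {0} {0, 1} (by decide) 2
  have e1 : ({2} ∪ {0, 1} : Finset (Fin 3)).card = 3 := by decide
  have e2 : ({2} ∪ {0} : Finset (Fin 3)).card = 2 := by decide
  have e3 : ({0, 1} : Finset (Fin 3)).card = 2 := by decide
  simp only [marginal, xosExample, e1, e2, e3, Finset.card_singleton] at h1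
  norm_num at h1

theorem cfExample_mem_CF : cfExample ∈ CF (Fin 3) := by
  intro A B
  simp only [cfExample, ← Nat.cast_add, Nat.cast_le]
  revert A B
  decide +kernel

theorem cfExample_not_hasSupports : ¬ HasSupports cfExample := by
  intro h
  obtain ⟨w, -, hS, hT⟩ := h Finset.univ
  have h01 := hT {0, 1}
  have h02 := hT {0, 2}
  have h12 := hT {1, 2}
  have e01 : ({0, 1} : Finset (Fin 3)).card = 2 := by decide
  have e02 : ({0, 2} : Finset (Fin 3)).card = 2 := by decide
  have e12 : ({1, 2} : Finset (Fin 3)).card = 2 := by decide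
  rw [Finset.sum_pair (by decide)] at h01 h02 h12
  simp only [cfExample, e01, e02, e12, Finset.card_univ, Fintype.card_fin, Fin.sum_univ_three]
    at hS h01 h02 h12
  norm_num at hS h01 h02 h12
  -- Adding the three pair bounds gives `2 * (w 0 + w 1 + w 2) ≤ 9`, while the total weight is 5.
  linarith

end Examples

/-! ### Assembly of the main theorem -/

theorem exists_embedding_fin {X : Type*} [Fintype X] {n : ℕ} (h : n ≤ Fintype.card X) :
    Nonempty (Fin n ↪ X) :=
  Function.Embedding.nonempty_of_card_le (by simpa using h)

theorem ssubset_of_mem_of_notMem {β : Type*} {s t : Set β} (h : s ⊆ t) {x : β} (hx : x ∈ t)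
    (hx' : x ∉ s) : s ⊂ t :=
  ⟨h, fun h' => hx' (h' hx)⟩

end CombinatorialAuction

theorem mainTheorem3 :
    -- the containments, on every non-empty finite set of items
    (∀ (X : Type*) [Fintype X] [DecidableEq X] [Nonempty X],
      CombinatorialAuction.OXS X ⊆ CombinatorialAuction.GS X ∧
      CombinatorialAuction.GS X ⊆ CombinatorialAuction.SM X ∧
      CombinatorialAuction.SM X ⊆ CombinatorialAuction.XOS X ∧
      CombinatorialAuction.XOS X ⊆ CombinatorialAuction.CF X ∧
      -- they are strict as soon as there are enough items
      (4 ≤ Fintype.card X → CombinatorialAuction.OXS X ⊂ CombinatorialAuction.GS X) ∧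
      (3 ≤ Fintype.card X →
        CombinatorialAuction.GS X ⊂ CombinatorialAuction.SM X ∧
        CombinatorialAuction.SM X ⊂ CombinatorialAuction.XOS X ∧
        CombinatorialAuction.XOS X ⊂ CombinatorialAuction.CF X)) ∧
    -- explicit separating examples
    (CombinatorialAuction.fourItemExample ∈ CombinatorialAuction.GS (Fin 4) ∧
      CombinatorialAuction.fourItemExample ∉ CombinatorialAuction.OXS (Fin 4)) ∧
    (CombinatorialAuction.budgetExample ∈ CombinatorialAuction.SM (Fin 3) ∧
      CombinatorialAuction.budgetExample ∉ CombinatorialAuction.GS (Fin 3)) ∧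
    (CombinatorialAuction.xosExample ∈ CombinatorialAuction.XOS (Fin 3) ∧
      CombinatorialAuction.xosExample ∉ CombinatorialAuction.SM (Fin 3)) ∧
    (CombinatorialAuction.cfExample ∈ CombinatorialAuction.CF (Fin 3) ∧
      CombinatorialAuction.cfExample ∉ CombinatorialAuction.XOS (Fin 3)) := by
  open CombinatorialAuction in
  refine ⟨fun X _ _ _ => ⟨OXS_subset_GS, GS_subset_SM, SM_subset_XOS, XOS_subset_CF,
    fun h => ?_, fun h => ?_⟩, ⟨fourItemExample_hasExchange.mem_GS, fun h => ?_⟩,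
    ⟨budgetExample_mem_SM, budgetExample_notMem_GS⟩,
    ⟨xosExample_hasSupports.mem_XOS, xosExample_notMem_SM⟩,
    ⟨cfExample_mem_CF, fun h => cfExample_not_hasSupports (hasSupports_of_mem_XOS h)⟩⟩
  · obtain ⟨e⟩ := exists_embedding_fin h
    exact ssubset_of_mem_of_notMem OXS_subset_GS
      (fourItemExample_hasExchange.extend (e := e)).mem_GS (fourItemExample_extend_notMem_OXS e)
  · obtain ⟨e⟩ := exists_embedding_fin h
    exact ⟨ssubset_of_mem_of_notMem GS_subset_SM (extend_mem_SM (e := e) budgetExample_mem_SM)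
        fun h => budgetExample_notMem_GS (mem_GS_of_extend h),
      ssubset_of_mem_of_notMem SM_subset_XOS (xosExample_hasSupports.extend (e := e)).mem_XOS
        fun h => xosExample_notMem_SM (mem_SM_of_extend h),
      ssubset_of_mem_of_notMem XOS_subset_CF (extend_mem_CF (e := e) cfExample_mem_CF)
        fun h => cfExample_not_hasSupports (hasSupports_of_mem_XOS h).of_extend⟩
  · refine fourItemExample_extend_notMem_OXS (Function.Embedding.refl _) ?_
    have : extend (Function.Embedding.refl _) fourItemExample = fourItemExample := by
      ext S
      simpa using extend_map (Function.Embedding.refl _) fourItemExample S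
    rwa [this]
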